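/- An operator space is a closed linear subspace $X$ of $B(H)$ for some complex Hilbert space $H$, with the norms $\|\cdot\|_{M_n(X)}$ on the matrix spaces $M_n(X)$ inherited from $M_n(B(H)) = B(H^n)$. A bounded linear map $u\colon X\to Y$ between operator spaces is completely bounded (c.b.) if $\sup_n\|u_n\|<\infty$, where $u_n\colon M_n(X)\to M_n(Y)$, $u_n([x_{ij}])=[u(x_{ij})]$; it is a complete isomorphic embedding if moreover there is $c>0$ with $\|u_n(x)\|_{M_n(Y)}\ge c\,\|x\|_{M_n(X)}$ for all $n$ and all $x\in M_n(X)$. Let $(e_{ij})$ be the matrix units of $B(\ell_2)$, and let $R=\overline{\mathrm{span}}\{e_{1i}: i\in\mathbb N\}$ and $C=\overline{\mathrm{span}}\{e_{i1}: i\in\mathbb N\}$ be the row and column operator spaces. An operator space is Hilbertian if it is isomorphic, as a Banach space, to a Hilbert space. A bounded operator $T\colon E\to F$ between Banach spaces is strictly cosingular if, for every infinite-dimensional Banach space $F_0$ and every bounded operator $q\colon F\to F_0$, the operator $qT$ is not surjective. For a sequence $(Y_i)_{i\in\mathbb N}$ of operator spaces, $(\bigoplus_i Y_i)_{c_0}$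 is the space of all $(y_i)_i$ with $y_i\in Y_i$ and $\lim_i\|y_i\|=0$, with $\|[x_{ab}]\|_{M_n((\bigoplus_i Y_i)_{c_0})}=\sup_i\|[x_{ab}(i)]\|_{M_n(Y_i)}$. \textbf{Statement.} Let $X_0$ be either $R$ or $C$, and let $X$ be a Hilbertian operator space for which there exists a completely bounded surjection from $X$ onto $X_0$. Let $(Y_i)_{i\in\mathbb N}$ be a sequence of operator spaces such that, for every $i\in\mathbb N$, every completely bounded operator from $Y_i$ to $X_0$ is strictly cosingular. Then there is no complete isomorphic embedding of $X$ into $(\bigoplus_i Y_i)_{c_0}$. -/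

import Mathlib

open scoped ENNReal Topology
open Filter

noncomputable section

namespace OpSpace

universe u v w

/-! ### Matrices of operators -/

/-- `B(H)`, the bounded operators on `H`. -/
abbrev BOp (H : Type u) [NormedAddCommGroup H] [InnerProductSpace ℂ H] : Type u := H →L[ℂ] H

/-- An `n × n` matrix `[T i j]` of bounded operators on `H`, as a bounded operator on the Hilbert
space direct sum `H ⊕ ⋯ ⊕ H` of `n` copies of `H`: `(T ξ) i = ∑ j, T i j (ξ j)`. This is the
identification `M_n(B(H)) = B(Hⁿ)`, and `‖opMatrix T‖` is the usual norm on `M_n(B(H))`. -/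
def opMatrix {H : Type u} [NormedAddCommGroup H] [InnerProductSpace ℂ H] {n : ℕ}
    (T : Matrix (Fin n) (Fin n) (BOp H)) :
    PiLp 2 (fun _ : Fin n => H) →L[ℂ] PiLp 2 (fun _ : Fin n => H) :=
  ((PiLp.continuousLinearEquiv 2 ℂ (fun _ : Fin n => H)).symm :
      (Fin n → H) →L[ℂ] PiLp 2 (fun _ : Fin n => H)) ∘L
    ContinuousLinearMap.pi fun i => ∑ j, (T i j) ∘L PiLp.proj 2 (fun _ : Fin n => H) j

theorem opMatrix_apply {H : Type u} [NormedAddCommGroup H] [InnerProductSpace ℂ H] {n : ℕ}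
    (T : Matrix (Fin n) (Fin n) (BOp H)) (ξ : PiLp 2 (fun _ : Fin n => H)) (i : Fin n) :
    opMatrix T ξ i = ∑ j, T i j (ξ j) := by
  simp [opMatrix]

/-! ### Operator spaces -/

/-- An operator space: a complex Banach space `X` with a norm on each matrix space `M_n(X)`,
coming from a linear isometry of `X` into some `B(H)`, `H` a Hilbert space
(that is, `X` is identified with a closed subspace of `B(H)`, and `M_n(X)` with the corresponding
subspace of `M_n(B(H)) = B(Hⁿ)`). -/
class OperatorSpace (X : Type u) [NormedAddCommGroup X] [NormedSpace ℂ X] : Type u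
    extends CompleteSpace X where
  matNorm : ∀ {n : ℕ}, Matrix (Fin n) (Fin n) X → ℝ
  exists_representation : ∃ (H : Type u) (_ : NormedAddCommGroup H) (_ : InnerProductSpace ℂ H)
    (_ : CompleteSpace H) (J : X →ₗᵢ[ℂ] (BOp H)),
    ∀ {n : ℕ} (x : Matrix (Fin n) (Fin n) X), matNorm x = ‖opMatrix (x.map J)‖

open OperatorSpace (matNorm)

/-- A closed (equivalently, complete) subspace of `B(H)` is an operator space. -/
instance instOperatorSpaceSubmodule {H : Type u} [NormedAddCommGroup H] [InnerProductSpace ℂ H]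
    [CompleteSpace H] (S : Submodule ℂ (BOp H)) [CompleteSpace S] : OperatorSpace S where
  matNorm x := ‖opMatrix (x.map S.subtype)‖
  exists_representation := ⟨H, _, _, inferInstance, S.subtypeₗᵢ, fun _ => rfl⟩

/-! ### Row and column operator spaces -/

/-- The Hilbert space `ℓ₂`. -/
abbrev Ell2 : Type := lp (fun _ : ℕ => ℂ) 2

/-- The canonical orthonormal basis of `ℓ₂`. -/
def stdBasis (i : ℕ) : Ell2 := lp.single 2 i (1 : ℂ)

/-- The matrix unit `e_{ij} ∈ B(ℓ₂)`: `e_{ij} e_j = e_i` and `e_{ij} e_k = 0` for `k ≠ j`. -/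
def matrixUnit (i j : ℕ) : BOp Ell2 :=
  InnerProductSpace.rankOne ℂ (stdBasis i) (stdBasis j)

/-- The row operator space, the closed span of the matrix units in the first row. -/
def rowSpace : Submodule ℂ (BOp Ell2) :=
  (Submodule.span ℂ (Set.range fun i => matrixUnit 0 i)).topologicalClosure

/-- The column operator space, the closed span of the matrix units in the first column. -/
def columnSpace : Submodule ℂ (BOp Ell2) :=
  (Submodule.span ℂ (Set.range fun i => matrixUnit i 0)).topologicalClosure

/-! ### Classes of maps and of spaces -/

section Maps

variable {X : Type u} [NormedAddCommGroup X] [NormedSpace ℂ X]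
variable {Y : Type v} [NormedAddCommGroup Y] [NormedSpace ℂ Y]

/-- `u` is completely bounded: its amplifications `M_n(X) → M_n(Y)` are uniformly bounded. -/
def IsCompletelyBounded [OperatorSpace X] [OperatorSpace Y] (u : X →L[ℂ] Y) : Prop :=
  ∃ K : ℝ, ∀ (n : ℕ) (x : Matrix (Fin n) (Fin n) X), matNorm (x.map u) ≤ K * matNorm x

/-- `u` is a complete isomorphic embedding: it is completely bounded, and its amplifications are
bounded below uniformly in `n` (so `u` is injective with completely bounded inverse on its
range). -/
def IsCompleteIsomorphicEmbedding [OperatorSpace X] [OperatorSpace Y] (u : X →L[ℂ] Y) : Prop :=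
  IsCompletelyBounded u ∧
    ∃ c : ℝ, 0 < c ∧ ∀ (n : ℕ) (x : Matrix (Fin n) (Fin n) X), c * matNorm x ≤ matNorm (x.map u)

/-- `T : X → Y` is strictly cosingular: for every infinite-dimensional Banach space `Y₀` and every
bounded operator `q : Y → Y₀`, the composition `q ∘ T` is not surjective. (If `q ∘ T` is
surjective then so is `q`, so `Y₀ ≅ Y / ker q` may be taken in the universe of `Y`.) -/
def StrictlyCosingular (T : X →L[ℂ] Y) : Prop :=
  ∀ (Y₀ : Type v) [NormedAddCommGroup Y₀] [NormedSpace ℂ Y₀] [CompleteSpace Y₀],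
    ¬ FiniteDimensional ℂ Y₀ → ∀ q : Y →L[ℂ] Y₀, ¬ Function.Surjective (q ∘L T)

variable (X) in
/-- `X` is Hilbertian: isomorphic, as a Banach space, to a Hilbert space. -/
def IsHilbertian : Prop :=
  ∃ (H : Type u) (_ : NormedAddCommGroup H) (_ : InnerProductSpace ℂ H) (_ : CompleteSpace H),
    Nonempty (X ≃L[ℂ] H)

end Maps

/-! ### `c₀`-sums -/

/-- The `c₀`-sum of a sequence of normed spaces, as a subspace of their `ℓ_∞`-sum. -/
def c0Sum (Y : ℕ → Type v) [∀ i, NormedAddCommGroup (Y i)] [∀ i, NormedSpace ℂ (Y i)] :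
    Submodule ℂ (lp Y ∞) where
  carrier := {y | Tendsto (fun i => ‖y i‖) atTop (𝓝 0)}
  zero_mem' := by simp
  add_mem' {a b} ha hb := by
    simp only [Set.mem_ofPred_eq] at ha hb ⊢
    refine squeeze_zero (fun i => norm_nonneg _) (fun i => ?_) (by simpa using ha.add hb)
    exact norm_add_le (a i) (b i)
  smul_mem' c a ha := by
    simp only [Set.mem_ofPred_eq] at ha ⊢
    refine squeeze_zero (fun i => norm_nonneg _) (fun i => ?_) (by simpa using ha.const_mul ‖c‖)
    exact norm_smul_le c (a i)

theorem isClosed_c0Sum (Y : ℕ → Type v) [∀ i, NormedAddCommGroup (Y i)]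
    [∀ i, NormedSpace ℂ (Y i)] : IsClosed (c0Sum Y : Set (lp Y ∞)) := by
  rw [← isSeqClosed_iff_isClosed]
  intro f a hf ha
  change Tendsto (fun i => ‖a i‖) atTop (𝓝 0)
  rw [Metric.tendsto_atTop] at ha ⊢
  intro ε hε
  obtain ⟨N, hN⟩ := ha (ε / 2) (by positivity)
  have hfN : Tendsto (fun i => ‖f N i‖) atTop (𝓝 0) := hf N
  rw [Metric.tendsto_atTop] at hfN
  obtain ⟨M, hM⟩ := hfN (ε / 2) (by positivity)
  refine ⟨M, fun i hi => ?_⟩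
  have h1 := hM i hi
  have h2 := hN N le_rfl
  rw [dist_eq_norm] at h2
  have h3 := lp.norm_apply_le_norm ENNReal.top_ne_zero (f N - a) i
  have h4 : ‖a i‖ ≤ ‖f N i‖ + ‖(f N - a) i‖ := by
    have : a i = f N i - (f N - a) i := by simp
    calc ‖a i‖ = ‖f N i - (f N - a) i‖ := by rw [← this]
      _ ≤ _ := norm_sub_le _ _
  simp only [dist_zero_right, norm_norm] at h1 ⊢
  linarith

section Diagonal

variable {K : ℕ → Type v} [∀ i, NormedAddCommGroup (K i)] [∀ i, InnerProductSpace ℂ (K i)]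

theorem hasSum_norm_sq {K : ℕ → Type v} [∀ i, NormedAddCommGroup (K i)] (f : lp K 2) : HasSum (fun i => ‖f i‖ ^ 2) (‖f‖ ^ 2) := by
  simpa using lp.hasSum_norm (p := 2) (by simp) f

theorem memlp_two_of_le {K : ℕ → Type v} [∀ i, NormedAddCommGroup (K i)] {f : ∀ i, K i} (g : lp K 2) {C : ℝ} (h : ∀ i, ‖f i‖ ≤ C * ‖g i‖) :
    Memℓp f 2 := by
  refine memℓp_gen ?_
  refine Summable.of_nonneg_of_le (fun i => by positivity) (fun i => ?_)
    ((hasSum_norm_sq g).summable.mul_left (C ^ 2))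
  have := pow_le_pow_left₀ (norm_nonneg _) (h i) 2
  simpa [mul_pow] using this

/-- The block diagonal operator on the Hilbert space direct sum of the `K i` with blocks `T i`. -/
def diag (T : ∀ i, BOp (K i)) (C : ℝ) (hT : ∀ i, ‖T i‖ ≤ C) : BOp (lp K 2) :=
  LinearMap.mkContinuous
    { toFun := fun ξ => ⟨fun i => T i (ξ i), memlp_two_of_le ξ (C := C) fun i =>
        (T i).le_of_opNorm_le (hT i) (ξ i)⟩
      map_add' := fun ξ η => by ext i; exact (T i).map_add _ _
      map_smul' := fun c ξ => by ext i; exact (T i).map_smul c _ } C (fun ξ => by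
    have hC : 0 ≤ C := (norm_nonneg _).trans (hT 0)
    refine le_of_sq_le_sq ?_ (by positivity)
    rw [mul_pow]
    refine hasSum_le (fun i => ?_) (hasSum_norm_sq _) ((hasSum_norm_sq ξ).mul_left (C ^ 2))
    rw [← mul_pow]
    exact pow_le_pow_left₀ (norm_nonneg _) ((T i).le_of_opNorm_le (hT i) (ξ i)) 2)

theorem norm_diag_le (T : ∀ i, BOp (K i)) (C : ℝ) (hT : ∀ i, ‖T i‖ ≤ C) :
    ‖diag T C hT‖ ≤ C :=
  LinearMap.mkContinuous_norm_le _ ((norm_nonneg _).trans (hT 0)) _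

theorem diag_apply (T : ∀ i, BOp (K i)) (C : ℝ) (hT : ∀ i, ‖T i‖ ≤ C) (ξ : lp K 2) (i : ℕ) :
    diag T C hT ξ i = T i (ξ i) := rfl

theorem pi_norm_sq {H : Type u} [NormedAddCommGroup H] {n : ℕ}
    (ξ : PiLp 2 (fun _ : Fin n => H)) : ‖ξ‖ ^ 2 = ∑ a, ‖ξ a‖ ^ 2 :=
  PiLp.norm_sq_eq_of_L2 _ ξ

/-- The norm of a matrix of block diagonal operators is the supremum of the norms of the blocks. -/
theorem isLUB_norm_opMatrix_diag {n : ℕ} (T : ∀ i, Matrix (Fin n) (Fin n) (BOp (K i)))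
    (D : Matrix (Fin n) (Fin n) (BOp (lp K 2)))
    (hD : ∀ a b ξ i, D a b ξ i = T i a b (ξ i)) :
    IsLUB (Set.range fun i => ‖opMatrix (T i)‖) ‖opMatrix D‖ := by
  have key : ∀ (ξ : PiLp 2 (fun _ : Fin n => lp K 2)) (i : ℕ) (a : Fin n),
      opMatrix D ξ a i = opMatrix (T i) (WithLp.toLp 2 fun b => ξ b i) a := by
    intro ξ i a
    rw [opMatrix_apply, opMatrix_apply, lp.coeFn_sum, Finset.sum_apply]
    exact Finset.sum_congr rfl fun b _ => hD a b _ i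
  constructor
  · rintro _ ⟨i, rfl⟩
    refine ContinuousLinearMap.opNorm_le_bound _ (ContinuousLinearMap.opNorm_nonneg _) fun η => ?_
    let ξ : PiLp 2 (fun _ : Fin n => lp K 2) := WithLp.toLp 2 fun b => lp.single 2 i (η b)
    have hξη : (WithLp.toLp 2 fun b => ξ b i : PiLp 2 (fun _ : Fin n => K i)) = η := by
      ext b; simp [ξ]
    have hξ : ‖ξ‖ = ‖η‖ := by
      have : ‖ξ‖ ^ 2 = ‖η‖ ^ 2 := by
        rw [pi_norm_sq, pi_norm_sq]
        refine Finset.sum_congr rfl fun b _ => ?_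
        simp [ξ, lp.norm_single]
      exact (sq_eq_sq₀ (norm_nonneg _) (norm_nonneg _)).1 this
    have h1 : ‖opMatrix (T i) η‖ ≤ ‖opMatrix D ξ‖ := by
      refine le_of_sq_le_sq ?_ (norm_nonneg _)
      rw [pi_norm_sq, pi_norm_sq]
      refine Finset.sum_le_sum fun a _ => ?_
      have := lp.norm_apply_le_norm (p := 2) (by simp) (opMatrix D ξ a) i
      rw [key, hξη] at this
      exact pow_le_pow_left₀ (norm_nonneg _) this 2
    calc _ ≤ _ := h1
      _ ≤ _ := (opMatrix D).le_opNorm ξ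
      _ = _ := by rw [hξ]
  · intro C hC
    have hC' : ∀ i, ‖opMatrix (T i)‖ ≤ C := fun i => hC ⟨i, rfl⟩
    have hC0 : 0 ≤ C := (ContinuousLinearMap.opNorm_nonneg _).trans (hC' 0)
    refine ContinuousLinearMap.opNorm_le_bound _ hC0 fun ξ => ?_
    refine le_of_sq_le_sq ?_ (by positivity)
    rw [mul_pow, pi_norm_sq, pi_norm_sq]
    have h1 := hasSum_sum (s := Finset.univ) fun a _ => hasSum_norm_sq (opMatrix D ξ a)
    have h2 := (hasSum_sum (s := Finset.univ) fun a _ => hasSum_norm_sq (ξ a)).mul_left (C ^ 2)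
    refine hasSum_le (fun i => ?_) h1 h2
    have h3 := (opMatrix (T i)).le_of_opNorm_le (hC' i) (WithLp.toLp 2 fun b => ξ b i)
    have h4 := pow_le_pow_left₀ (norm_nonneg _) h3 2
    rw [mul_pow, pi_norm_sq, pi_norm_sq] at h4
    simpa [key] using h4

end Diagonal


section Instance

variable (Y : ℕ → Type v) [∀ i, NormedAddCommGroup (Y i)] [∀ i, NormedSpace ℂ (Y i)]
  [∀ i, OperatorSpace (Y i)]

/-- The `c₀`-sum of a sequence of operator spaces, with
`‖[x_{ab}]‖ = sup_i ‖[x_{ab}(i)]‖`, is an operator space. -/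
instance instOperatorSpaceC0Sum : OperatorSpace (c0Sum Y) where
  toCompleteSpace := (isClosed_c0Sum Y).completeSpace_coe
  matNorm x := ⨆ i, matNorm (x.map fun y => (y : lp Y ∞) i)
  exists_representation := by
    choose H i1 i2 i3 J hJ using fun i => OperatorSpace.exists_representation (X := Y i)
    have hb : ∀ (y : c0Sum Y) (i : ℕ), ‖J i ((y : lp Y ∞) i)‖ ≤ ‖y‖ := fun y i => by
      rw [LinearIsometry.norm_map]
      exact lp.norm_apply_le_norm ENNReal.top_ne_zero (y : lp Y ∞) i
    let D : c0Sum Y →ₗ[ℂ] (BOp (lp H 2)) :=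
      { toFun := fun y => diag (fun i => J i ((y : lp Y ∞) i)) ‖y‖ (hb y)
        map_add' := fun y z => by ext ξ i; simp [diag_apply]
        map_smul' := fun c y => by ext ξ i; simp [diag_apply] }
    have hD : ∀ (y : c0Sum Y) (ξ : lp H 2) (i : ℕ), D y ξ i = J i ((y : lp Y ∞) i) (ξ i) :=
      fun _ _ _ => rfl
    have hnorm : ∀ y, ‖D y‖ = ‖y‖ := by
      intro y
      refine le_antisymm (norm_diag_le _ _ (hb y)) ?_
      refine lp.norm_le_of_forall_le (norm_nonneg _) fun i => ?_
      rw [← (J i).norm_map]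
      refine ContinuousLinearMap.opNorm_le_bound _ (norm_nonneg _) fun η => ?_
      have h1 := lp.norm_apply_le_norm (p := 2) (by simp) (D y (lp.single 2 i η)) i
      rw [hD, lp.single_apply_self] at h1
      refine h1.trans (((D y).le_opNorm _).trans_eq ?_)
      rw [lp.norm_single (by simp)]
    refine ⟨lp H 2, inferInstance, inferInstance, inferInstance, ⟨D, hnorm⟩, ?_⟩
    intro n x
    refine IsLUB.ciSup_eq ?_
    simp only [hJ]
    exact isLUB_norm_opMatrix_diag _ _ fun a b ξ i => rfl

end Instance

end OpSpace

/-! Suppose `u` embeds `X` in the `c₀`-sum `Z`, and let `v : X → X₀` be a completely bounded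
surjection. The row and column spaces are injective (`exists_completelyBounded_extension`), so `v =
W ∘ u` with `W : Z → X₀` completely bounded. As `X` and `X₀` are Hilbertian, `W ∘ u` becomes a
surjection from a Hilbert space onto `ℓ₂`. It is also small in the sense of `IsSmall` (that is,
compact), which is impossible because `ℓ₂` is infinite dimensional.

Smallness has two sources. An operator from a `c₀`-sum to a Hilbert space is the norm limit of its
truncations (`exists_norm_sub_c0Trunc_le`): otherwise disjoint blocks with suitable signs would stay
in the unit ball while their images grow like `√N`. Each truncation is a finite sum of operators
factoring through completely bounded maps `Y i → X₀`. These are strictly cosingular, hence small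
between Hilbert spaces (`StrictlyCosingular.isSmall`).

Injectivity is proved by domination. A column estimate for `v` against `u` yields, by a convexity
argument, a positive functional `f` with `‖v x‖² ≤ f (u(x)* u(x))`. Thus `v` factors through the GNS
space of `f`, where an orthogonal projection extends it. Rows are reduced to columns by adjoints and
the opposite algebra. -/

namespace OpSpace

universe u v w

open OperatorSpace (matNorm)

/-! ### Domination by a positive functional and extension through the GNS space -/

section Factorization

variable {A : Type u} [CStarAlgebra A] {X : Type v} [AddCommGroup X] [Module ℂ X]
  {H : Type w} [NormedAddCommGroup H] [InnerProductSpace ℂ H]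

open scoped ComplexStarModule ComplexOrder

/-- The cone of pairs `(a, r)` on which a functional dominating `v` on the squares of `u` and of
mass at most `M` is forced to satisfy `r ≤ f a`. -/
def dominationCone [PartialOrder A] [StarOrderedRing A] (u : X →ₗ[ℂ] A) (v : X →ₗ[ℂ] H) (M : ℝ) :
    PointedCone ℝ (A × ℝ) where
  carrier := {p | ∃ (L : List X) (t : ℝ), 0 ≤ t ∧
    (L.map fun x => star (u x) * u x).sum ≤ (ℜ p.1 : A) + t • (1 : A) ∧
    p.2 ≤ (L.map fun x => ‖v x‖ ^ 2).sum - M * t}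
  zero_mem' := ⟨[], 0, le_rfl, by simp, by simp⟩
  add_mem' := by
    rintro ⟨a, r⟩ ⟨b, s⟩ ⟨L, t, ht, h1, h2⟩ ⟨L', t', ht', h1', h2'⟩
    refine ⟨L ++ L', t + t', add_nonneg ht ht', ?_, ?_⟩
    · simp only [List.map_append, List.sum_append, Prod.mk_add_mk, map_add, AddSubgroup.coe_add,
        add_smul] at h1 h1' ⊢
      exact (add_le_add h1 h1').trans_eq (by abel)
    · simp only [List.map_append, List.sum_append, Prod.mk_add_mk] at h2 h2' ⊢
      linarith
  smul_mem' := by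
    rintro ⟨c, hc⟩ ⟨a, r⟩ ⟨L, t, ht, h1, h2⟩
    -- Both sums are quadratic in `x`, so scaling the list by `√c` scales them by `c`.
    have hs : (√c * √c : ℝ) = c := Real.mul_self_sqrt hc
    refine ⟨L.map fun x => ((√c : ℝ) : ℂ) • x, c * t, mul_nonneg hc ht, ?_, ?_⟩
    · have e1 : ∀ x : X, star (u (((√c : ℝ) : ℂ) • x)) * u (((√c : ℝ) : ℂ) • x) =
          c • (star (u x) * u x) := fun x => by
        rw [map_smul, star_smul, smul_mul_smul_comm]
        simp only [RCLike.star_def, Complex.conj_ofReal]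
        rw [← Complex.ofReal_mul, hs, Complex.coe_smul]
      have e2 := smul_le_smul_of_nonneg_left h1 hc
      simp only [List.map_map, Function.comp_def, e1]
      rw [← Function.comp_def (fun a : A => c • a), ← List.map_map, ← List.smul_sum]
      refine e2.trans_eq ?_
      simp [smul_smul]
    · have e1 : ∀ x : X, ‖v (((√c : ℝ) : ℂ) • x)‖ ^ 2 = c * ‖v x‖ ^ 2 := fun x => by
        rw [map_smul, norm_smul, mul_pow, Complex.norm_real, Real.norm_eq_abs, sq_abs,
          Real.sq_sqrt hc]
      simp only [List.map_map, Function.comp_def, e1]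
      rw [List.sum_map_mul_left]
      have := mul_le_mul_of_nonneg_left h2 hc
      change c * r ≤ _
      simp only at this
      linarith

/-- A Pietsch-type domination theorem: a map which is bounded on columns is dominated by a positive
functional. -/
theorem exists_dominating_functional [PartialOrder A] [StarOrderedRing A] (u : X →ₗ[ℂ] A)
    (v : X →ₗ[ℂ] H) (M : ℝ) (hM : 0 ≤ M)
    (h : ∀ L : List X, (L.map fun x => ‖v x‖ ^ 2).sum ≤
      M * ‖(L.map fun x => star (u x) * u x).sum‖) :
    ∃ f : A →ₚ[ℂ] ℂ, (f 1).re ≤ M ∧ ∀ x, ‖v x‖ ^ 2 ≤ (f (star (u x) * u x)).re := by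
  have hpos : ∀ L : List X, 0 ≤ (L.map fun x => star (u x) * u x).sum := fun L =>
    List.sum_nonneg (by simp only [List.mem_map]; rintro _ ⟨x, -, rfl⟩; exact star_mul_self_nonneg _)
  -- On `0 × ℝ` the functional `(0, r) ↦ -r` is nonnegative on the cone exactly because of `h`. A
  -- positive extension has the form `g (a, r) = f a - r`, so on the cone `r ≤ f a`.
  obtain ⟨g, hg, hgS⟩ := riesz_extension (dominationCone u v M)
    ((-(LinearMap.snd ℝ A ℝ)).toPMap (LinearMap.range (LinearMap.inr ℝ A ℝ)))
    (by
      rintro ⟨_, r, rfl⟩ ⟨L, t, ht, h1, h2⟩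
      simp only [LinearMap.coe_inr, map_zero, ZeroMemClass.coe_zero, zero_add] at h1 h2
      change 0 ≤ -r
      have h3 : ‖(L.map fun x => star (u x) * u x).sum‖ ≤ t := by
        rw [CStarAlgebra.norm_le_iff_le_algebraMap _ ht (hpos L), Algebra.algebraMap_eq_smul_one]
        exact h1
      have := h L
      nlinarith)
    (by
      rintro ⟨a, r⟩
      refine ⟨⟨_, -r - M * ‖(ℜ a : A)‖, rfl⟩, [], ‖(ℜ a : A)‖, norm_nonneg _, ?_, ?_⟩
      · have := (ℜ a).2.neg_algebraMap_norm_le_self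
        rw [Algebra.algebraMap_eq_smul_one] at this
        simpa [neg_le_iff_add_nonneg] using this
      · simp only [LinearMap.coe_inr, Prod.mk_add_mk, List.map_nil, List.sum_nil]
        linarith)
  let f : A →ₗ[ℝ] ℝ := g ∘ₗ LinearMap.inl ℝ A ℝ
  have hf : ∀ a r, (a, r) ∈ dominationCone u v M → r ≤ f a := by
    intro a r har
    have h1 := hgS _ har
    have h2 := hg ⟨_, r, rfl⟩
    change g (0, r) = -r at h2
    have h3 : g (a, r) = f a + g (0, r) := by
      rw [LinearMap.comp_apply, ← map_add]; simp
    linarith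
  have hre : ∀ a : A, 0 ≤ (ℜ a : A) → 0 ≤ f a := fun a ha =>
    hf a 0 ⟨[], 0, le_rfl, by simpa using ha, by simp⟩
  let F : A →ₗ[ℂ] ℂ := Module.Dual.extendRCLike (𝕜 := ℂ) f
  have hFre : ∀ a, (F a).re = f a := fun a => by
    simp [F, Module.Dual.extendRCLike_apply]
  have hF : ∀ a, 0 ≤ a → 0 ≤ F a := by
    intro a ha
    have hsa : ℜ a = ⟨a, ha.isSelfAdjoint⟩ := Subtype.ext ha.isSelfAdjoint.coe_realPart
    -- Both `I • a` and its negative have real part zero, so `f` is nonnegative at each.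
    have him : f (Complex.I • a) = 0 := by
      have h0 : (ℜ (Complex.I • a) : A) = 0 := by
        simp [ha.isSelfAdjoint.imaginaryPart]
      refine le_antisymm ?_ (hre _ h0.ge)
      have := hre (-(Complex.I • a)) (by rw [map_neg, AddSubgroup.coe_neg, h0, neg_zero])
      rw [map_neg] at this
      linarith
    rw [RCLike.nonneg_iff (K := ℂ)]
    refine ⟨?_, ?_⟩
    · change 0 ≤ (F a).re
      rw [hFre]
      exact hre a (by rw [hsa]; exact ha)
    · simp [F, Module.Dual.extendRCLike_apply, him]
  refine ⟨PositiveLinearMap.mk₀ F hF, ?_, fun x => ?_⟩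
  · change (F 1).re ≤ M
    rw [hFre]
    -- The empty list with `t = 1` bounds the mass of `f`.
    have := hf (-1) (-M) ⟨[], 1, zero_le_one, by simp, by simp⟩
    rw [map_neg] at this
    linarith
  · change _ ≤ (F _).re
    rw [hFre]
    refine hf _ _ ⟨[x], 0, le_rfl, ?_, by simp⟩
    simp [(IsSelfAdjoint.star_mul_self (u x)).coe_realPart]

/-- A Hilbert space valued map on a subspace of a C⋆-algebra which is bounded on columns extends
to the whole algebra, with the same bound on columns. -/
theorem exists_extension_of_column_bounded [CompleteSpace H] (u : X →ₗ[ℂ] A)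
    (v : X →ₗ[ℂ] H) (M : ℝ) (hM : 0 ≤ M)
    (h : ∀ L : List X, (L.map fun x => ‖v x‖ ^ 2).sum ≤
      M * ‖(L.map fun x => star (u x) * u x).sum‖) :
    ∃ W : A →ₗ[ℂ] H, (∀ x, W (u x) = v x) ∧
      ∀ {ι : Type} (s : Finset ι) (a : ι → A),
        ∑ i ∈ s, ‖W (a i)‖ ^ 2 ≤ M * ‖∑ i ∈ s, star (a i) * a i‖ := by
  let _ : PartialOrder A := CStarAlgebra.spectralOrder A
  have _ : StarOrderedRing A := CStarAlgebra.spectralOrderedRing A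
  obtain ⟨f, hf1, hf⟩ := exists_dominating_functional u v M hM h
  let Φ : A →ₗ[ℂ] f.GNS :=
    (UniformSpace.Completion.toComplL (𝕜 := ℂ) (E := f.PreGNS)).toLinearMap ∘ₗ
      f.toPreGNS.toLinearMap
  have hΦ : ∀ a, ‖Φ a‖ ^ 2 = (f (star a * a)).re := by
    intro a
    have h1 : ‖Φ a‖ = ‖f.toPreGNS a‖ := UniformSpace.Completion.norm_coe _
    have h2 := f.preGNS_norm_sq (f.toPreGNS a)
    rw [h1, ← f.ofPreGNS_toPreGNS a, ← h2, f.ofPreGNS_toPreGNS]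
    norm_cast
  -- Domination reads `‖v x‖ ≤ ‖Φ (u x)‖`, so `v` induces a contraction on `K`; the orthogonal
  -- projection onto `K` extends it to the whole GNS space without increasing the norm.
  let K : Submodule ℂ f.GNS := (LinearMap.range (Φ ∘ₗ u)).topologicalClosure
  have hK : CompleteSpace K := (Submodule.isClosed_topologicalClosure _).completeSpace_coe
  let e : X →ₗ[ℂ] K := (Φ ∘ₗ u).codRestrict K fun x =>
    Submodule.le_topologicalClosure _ (LinearMap.mem_range_self _ x)
  have he : DenseRange e := by
    rw [DenseRange, Subtype.dense_iff]
    intro y hy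
    convert! hy
    rw [← Set.range_comp]
    rfl
  have hn : ∀ x, ‖v x‖ ≤ 1 * ‖e x‖ := fun x => by
    rw [one_mul]
    refine le_of_sq_le_sq ?_ (norm_nonneg _)
    change _ ≤ ‖Φ (u x)‖ ^ 2
    rw [hΦ]
    exact hf x
  let T := v.extendOfNorm e
  refine ⟨T.toLinearMap ∘ₗ K.orthogonalProjectionOnto.toLinearMap ∘ₗ Φ, fun x => ?_, ?_⟩
  · have : K.orthogonalProjectionOnto (Φ (u x)) = e x :=
      Submodule.orthogonalProjectionOnto_mem_subspace_eq_self (e x)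
    change T (K.orthogonalProjectionOnto (Φ (u x))) = _
    rw [this]
    exact LinearMap.extendOfNorm_eq he ⟨1, hn⟩ x
  · intro ι s a
    have hW : ∀ a, ‖T (K.orthogonalProjectionOnto (Φ a))‖ ^ 2 ≤ (f (star a * a)).re := fun a => by
      rw [← hΦ]
      refine pow_le_pow_left₀ (norm_nonneg _) ?_ 2
      refine (LinearMap.norm_extendOfNorm_apply_le he 1 hn _).trans ?_
      rw [one_mul]
      exact K.norm_orthogonalProjectionOnto_apply_le _
    refine (Finset.sum_le_sum fun i _ => hW (a i)).trans ?_
    rw [← Complex.re_sum, ← map_sum]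
    set b := ∑ i ∈ s, star (a i) * a i with hb
    have hb0 : 0 ≤ b := Finset.sum_nonneg fun i _ => star_mul_self_nonneg _
    have h1 : b ≤ (‖b‖ : ℂ) • (1 : A) := by
      have := hb0.isSelfAdjoint.le_algebraMap_norm_self
      rwa [Algebra.algebraMap_eq_smul_one, ← Complex.coe_smul] at this
    have h2 := (OrderHomClass.mono f h1).1
    rw [map_smul, smul_eq_mul, Complex.re_ofReal_mul] at h2
    calc _ ≤ _ := h2
      _ ≤ _ := by rw [mul_comm]; gcongr

end Factorization

/-! ### Small operators between Hilbert spaces and strict cosingularity -/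

section SmallOperators

variable {E : Type u} [NormedAddCommGroup E] [InnerProductSpace ℂ E]
  {F : Type v} [NormedAddCommGroup F] [InnerProductSpace ℂ F]

/-- An operator between Hilbert spaces whose norm becomes arbitrarily small off suitable finite
dimensional subspaces. -/
def IsSmall (T : E →L[ℂ] F) : Prop :=
  ∀ ε : ℝ, 0 < ε → ∃ G : Submodule ℂ E, FiniteDimensional ℂ G ∧ ∀ x ∈ Gᗮ, ‖T x‖ ≤ ε * ‖x‖

theorem isSmall_zero : IsSmall (0 : E →L[ℂ] F) := fun ε hε =>
  ⟨⊥, inferInstance, fun x _ => by simpa using by positivity⟩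

theorem IsSmall.add {S T : E →L[ℂ] F} (hS : IsSmall S) (hT : IsSmall T) : IsSmall (S + T) := by
  intro ε hε
  obtain ⟨G, hG, h1⟩ := hS (ε / 2) (by positivity)
  obtain ⟨G', hG', h2⟩ := hT (ε / 2) (by positivity)
  refine ⟨G ⊔ G', inferInstance, fun x hx => ?_⟩
  rw [← Submodule.inf_orthogonal] at hx
  have := norm_add_le (S x) (T x)
  have := h1 x hx.1
  have := h2 x hx.2
  rw [add_apply]
  linarith

theorem isSmall_sum {ι : Type*} (s : Finset ι) (T : ι → E →L[ℂ] F) (h : ∀ i ∈ s, IsSmall (T i)) :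
    IsSmall (∑ i ∈ s, T i) :=
  Finset.sum_induction T IsSmall (fun _ _ => IsSmall.add) isSmall_zero h

theorem isSmall_of_approx {T : E →L[ℂ] F}
    (h : ∀ ε : ℝ, 0 < ε → ∃ S : E →L[ℂ] F, IsSmall S ∧ ∀ x, ‖T x - S x‖ ≤ ε * ‖x‖) :
    IsSmall T := by
  intro ε hε
  obtain ⟨S, hS, h1⟩ := h (ε / 2) (by positivity)
  obtain ⟨G, hG, h2⟩ := hS (ε / 2) (by positivity)
  refine ⟨G, hG, fun x hx => ?_⟩
  have := norm_add_le (T x - S x) (S x)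
  rw [sub_add_cancel] at this
  have := h1 x
  have := h2 x hx
  linarith

/-- By the open mapping theorem `T` is bounded below on `(ker T)ᗮ`, while smallness makes it tiny on
some `Gᗮ`. Hence `(ker T)ᗮ` projects injectively into the finite dimensional `G`, and `T` maps it
onto `F`. -/
theorem IsSmall.finiteDimensional_of_surjective [CompleteSpace E] [CompleteSpace F]
    {T : E →L[ℂ] F} (hT : IsSmall T) (hs : Function.Surjective T) : FiniteDimensional ℂ F := by
  obtain ⟨C, hC, hpre⟩ := T.exists_preimage_norm_le hs
  let N : Submodule ℂ E := LinearMap.ker T.toLinearMap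
  have hN : IsClosed (N : Set E) := T.isClosed_ker
  have : CompleteSpace N := hN.completeSpace_coe
  have hbelow : ∀ x ∈ Nᗮ, ‖x‖ ≤ C * ‖T x‖ := by
    intro x hx
    obtain ⟨y, hy, hy'⟩ := hpre (T x)
    refine le_trans ?_ hy'
    have hxy : y - x ∈ N := by simp [N, hy]
    have h0 : inner ℂ x (y - x) = 0 := Submodule.inner_left_of_mem_orthogonal hxy hx
    rw [inner_sub_right, sub_eq_zero] at h0
    have h1 : ‖x‖ * ‖x‖ ≤ ‖x‖ * ‖y‖ := by
      rw [← inner_self_eq_norm_mul_norm (𝕜 := ℂ), ← h0]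
      exact re_inner_le_norm x y
    rcases (norm_nonneg x).eq_or_lt with h | h
    · rw [← h]; exact norm_nonneg _
    · exact le_of_mul_le_mul_left h1 h
  -- With this constant, `x ∈ Nᗮ ⊓ Gᗮ` satisfies `‖x‖ ≤ C * ‖T x‖ ≤ ‖x‖ / 2`, so `x = 0`.
  obtain ⟨G, hG, hGs⟩ := hT (1 / (2 * C)) (by positivity)
  let p : Nᗮ →ₗ[ℂ] G := G.orthogonalProjectionOnto.toLinearMap ∘ₗ Nᗮ.subtype
  have hp : Function.Injective p := by
    rw [← LinearMap.ker_eq_bot, LinearMap.ker_eq_bot']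
    rintro ⟨x, hx⟩ h
    have hxG : x ∈ Gᗮ := G.orthogonalProjectionOnto_eq_zero_iff.1 h
    have h1 := hbelow x hx
    have h2 := mul_le_mul_of_nonneg_left (hGs x hxG) hC.le
    have h3 : C * (1 / (2 * C) * ‖x‖) = ‖x‖ / 2 := by field_simp
    have h4 : ‖x‖ = 0 := le_antisymm (by linarith) (norm_nonneg _)
    exact Subtype.ext (norm_eq_zero.1 h4)
  have := FiniteDimensional.of_injective p hp
  refine Module.Finite.of_surjective (T.toLinearMap ∘ₗ Nᗮ.subtype) fun y => ?_
  obtain ⟨x, rfl⟩ := hs y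
  refine ⟨⟨x - N.starProjection x, N.sub_starProjection_mem_orthogonal x⟩, ?_⟩
  have : T (N.starProjection x) = 0 := (N.starProjection_apply_mem x)
  simp [this]

theorem norm_sq_sum_of_pairwise_orthogonal {ι : Type*} (s : Finset ι) (y : ι → F)
    (h : Pairwise fun i j => inner ℂ (y i) (y j) = (0 : ℂ)) :
    ‖∑ i ∈ s, y i‖ ^ 2 = ∑ i ∈ s, ‖y i‖ ^ 2 := by
  classical
  induction s using Finset.induction_on with
  | empty => simp
  | insert a s ha ih =>
    rw [Finset.sum_insert ha, Finset.sum_insert ha, ← ih]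
    simp only [sq]
    refine norm_add_sq_eq_norm_sq_add_norm_sq_of_inner_eq_zero (𝕜 := ℂ) _ _ ?_
    rw [inner_sum]
    exact Finset.sum_eq_zero fun i hi => h (by rintro rfl; exact ha hi)

/-- An operator which is not small is bounded below on a closed infinite dimensional subspace. -/
theorem exists_bounded_below_of_not_isSmall [CompleteSpace E] [CompleteSpace F] {T : E →L[ℂ] F}
    (hT : ¬ IsSmall T) : ∃ (K : Submodule ℂ E) (ε : ℝ), IsClosed (K : Set E) ∧
      ¬ FiniteDimensional ℂ K ∧ 0 < ε ∧ ∀ x ∈ K, ε * ‖x‖ ≤ ‖T x‖ := by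
  unfold IsSmall at hT
  push Not at hT
  obtain ⟨ε, hε, h⟩ := hT
  have : Std.Symm fun x y : E => inner ℂ x y = 0 ∧ inner ℂ (T x) (T y) = 0 :=
    ⟨fun x y hxy => ⟨inner_eq_zero_symm.1 hxy.1, inner_eq_zero_symm.1 hxy.2⟩⟩
  obtain ⟨x, hx, hxy⟩ := exists_seq_of_forall_finset_exists'
    (fun x : E => ‖x‖ = 1 ∧ ε < ‖T x‖) (fun x y => inner ℂ x y = 0 ∧ inner ℂ (T x) (T y) = 0) (by
      classical
      intro s _
      -- Orthogonality to every earlier `y` and to `T* T y` makes both the vectors and their images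
      -- orthogonal.
      obtain ⟨z, hz, hzT⟩ := h (Submodule.span ℂ
        ((s ∪ s.image fun x => ContinuousLinearMap.adjoint T (T x) : Finset E) : Set E))
        (FiniteDimensional.span_finset ℂ _)
      have hz0 : z ≠ 0 := by rintro rfl; simp at hzT
      have hz1 : 0 < ‖z‖ := norm_pos_iff.2 hz0
      refine ⟨((‖z‖⁻¹ : ℝ) : ℂ) • z, ⟨?_, ?_⟩, fun y hy => ⟨?_, ?_⟩⟩
      · rw [norm_smul]; simp [hz1.ne']
      · rw [map_smul, norm_smul, Complex.norm_real, norm_inv, norm_norm, inv_mul_eq_div,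
          lt_div_iff₀ hz1]
        exact hzT
      · rw [inner_smul_right, Submodule.inner_right_of_mem_orthogonal
          (Submodule.subset_span (by simp [hy])) hz, mul_zero]
      · rw [map_smul, inner_smul_right, ← ContinuousLinearMap.adjoint_inner_left,
          Submodule.inner_right_of_mem_orthogonal (Submodule.subset_span
            (by
              simp only [Finset.coe_union, Finset.coe_image]
              exact Or.inr ⟨y, hy, rfl⟩)) hz, mul_zero])
  have hxo : Orthonormal ℂ x := ⟨fun i => (hx i).1, fun i j hij => (hxy hij).1⟩
  refine ⟨(Submodule.span ℂ (Set.range x)).topologicalClosure, ε,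
    Submodule.isClosed_topologicalClosure _, fun hfin => ?_, hε, fun y hy => ?_⟩
  · have hli : LinearIndependent ℂ fun i : ℕ =>
        (⟨x i, Submodule.le_topologicalClosure _ (Submodule.subset_span ⟨i, rfl⟩)⟩ :
          (Submodule.span ℂ (Set.range x)).topologicalClosure) :=
      LinearIndependent.of_comp (Submodule.subtype _) hxo.linearIndependent
    exact not_finite_iff_infinite.2 inferInstance hli.finite
  -- The bound passes to closures; on the span it follows from Pythagoras applied to the `x i` and
  -- to the `T (x i)`.
  · have hcl : IsClosed {y : E | ε * ‖y‖ ≤ ‖T y‖} := isClosed_le (by fun_prop) (by fun_prop)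
    refine closure_minimal ?_ hcl hy
    intro y hy
    obtain ⟨c, rfl⟩ := Finsupp.mem_span_range_iff_exists_finsupp.1 hy
    refine le_of_sq_le_sq ?_ (norm_nonneg _)
    rw [mul_pow, Finsupp.sum, map_sum, norm_sq_sum_of_pairwise_orthogonal,
      norm_sq_sum_of_pairwise_orthogonal, Finset.mul_sum]
    · refine Finset.sum_le_sum fun i _ => ?_
      rw [map_smul, norm_smul, norm_smul, (hx i).1, mul_one, mul_pow, mul_comm]
      gcongr
      exact (hx i).2.le
    · intro i j hij
      rw [map_smul, map_smul, inner_smul_left, inner_smul_right, (hxy hij).2, mul_zero, mul_zero]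
    · intro i j hij
      rw [inner_smul_left, inner_smul_right, (hxy hij).1, mul_zero, mul_zero]

/-- A strictly cosingular operator becomes small when composed with operators from and to Hilbert
spaces. -/
theorem StrictlyCosingular.isSmall [CompleteSpace E] [CompleteSpace F] {Y : Type w}
    [NormedAddCommGroup Y] [NormedSpace ℂ Y] {Z : Type v} [NormedAddCommGroup Z] [NormedSpace ℂ Z]
    {T : Y →L[ℂ] Z} (hT : StrictlyCosingular T) (s : E →L[ℂ] Y) (θ : Z →L[ℂ] F) :
    IsSmall (θ ∘L T ∘L s) := by
  by_contra hns
  obtain ⟨K, ε, hK, hinf, hε, hb⟩ := exists_bounded_below_of_not_isSmall hns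
  have : CompleteSpace K := hK.completeSpace_coe
  let S : K →L[ℂ] F := (θ ∘L T ∘L s) ∘L K.subtypeL
  have hanti : AntilipschitzWith (Real.toNNReal ε⁻¹) S := by
    refine AddMonoidHomClass.antilipschitz_of_bound S fun x => ?_
    rw [Real.coe_toNNReal _ (inv_pos.2 hε).le, inv_mul_eq_div, le_div_iff₀ hε, mul_comm]
    exact hb x x.2
  -- `S` is bounded below, so `G` is closed and infinite dimensional; projecting `θ ∘ T` onto `G` is
  -- already surjective on `s(K)`, against strict cosingularity.
  let G : Submodule ℂ F := LinearMap.range S.toLinearMap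
  have : CompleteSpace G := (hanti.isComplete_range S.uniformContinuous).completeSpace_coe
  refine hT G (fun hfin => hinf ?_) (G.orthogonalProjectionOnto ∘L θ) ?_
  · exact FiniteDimensional.of_injective S.toLinearMap.rangeRestrict fun x y hxy =>
      hanti.injective (congrArg Subtype.val hxy)
  · rintro ⟨_, x, rfl⟩
    refine ⟨s x, ?_⟩
    exact G.orthogonalProjectionOnto_mem_subspace_eq_self ⟨S x, x, rfl⟩

end SmallOperators

/-! ### Truncation in `c₀`-sums -/

section C0Sum

variable {Y : ℕ → Type v} [∀ i, NormedAddCommGroup (Y i)] [∀ i, NormedSpace ℂ (Y i)]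

/-- The inclusion of a summand in a `c₀`-sum. -/
def c0Single (i : ℕ) : Y i →L[ℂ] c0Sum Y :=
  (lp.singleContinuousLinearMap ℂ Y ∞ i).codRestrict (c0Sum Y) fun y => by
    change Tendsto (fun j => ‖lp.single ∞ i y j‖) atTop (𝓝 0)
    refine tendsto_const_nhds.congr' ?_
    filter_upwards [eventually_gt_atTop i] with j hj
    rw [lp.single_apply_ne _ _ _ hj.ne', norm_zero]

/-- The projection of a `c₀`-sum onto a summand. -/
def c0Proj (i : ℕ) : c0Sum Y →L[ℂ] Y i :=
  LinearMap.mkContinuous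
    { toFun := fun z => (z : lp Y ∞) i
      map_add' := fun _ _ => rfl
      map_smul' := fun _ _ => rfl } 1 fun z => by
    rw [one_mul]
    exact lp.norm_apply_le_norm ENNReal.top_ne_zero (z : lp Y ∞) i

theorem c0Proj_c0Single_self (i : ℕ) (y : Y i) : c0Proj i (c0Single i y) = y :=
  lp.single_apply_self ∞ i y

theorem c0Proj_c0Single_of_ne {i j : ℕ} (h : j ≠ i) (y : Y i) : c0Proj j (c0Single i y) = 0 :=
  lp.single_apply_ne ∞ i y h

theorem norm_c0Proj_le (i : ℕ) (z : c0Sum Y) : ‖c0Proj i z‖ ≤ ‖z‖ :=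
  lp.norm_apply_le_norm ENNReal.top_ne_zero (z : lp Y ∞) i

theorem norm_c0Sum_le {z : c0Sum Y} {C : ℝ} (hC : 0 ≤ C) (h : ∀ i, ‖c0Proj i z‖ ≤ C) : ‖z‖ ≤ C :=
  lp.norm_le_of_forall_le hC h

/-- Truncation to the first `n` summands. -/
def c0Trunc (n : ℕ) : c0Sum Y →L[ℂ] c0Sum Y := ∑ i ∈ Finset.range n, c0Single i ∘L c0Proj i

theorem c0Proj_c0Trunc (n j : ℕ) (z : c0Sum Y) :
    c0Proj j (c0Trunc n z) = if j < n then c0Proj j z else 0 := by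
  have h1 : c0Trunc n z = ∑ i ∈ Finset.range n, c0Single i (c0Proj i z) := by
    simp [c0Trunc]
  rw [h1, map_sum]
  split_ifs with h
  · rw [Finset.sum_eq_single_of_mem j (Finset.mem_range.2 h) fun i _ hi =>
      c0Proj_c0Single_of_ne hi.symm _, c0Proj_c0Single_self]
  · exact Finset.sum_eq_zero fun i hi => c0Proj_c0Single_of_ne
      (by rintro rfl; exact h (Finset.mem_range.1 hi)) _

theorem norm_c0Trunc_le (n : ℕ) (z : c0Sum Y) : ‖c0Trunc n z‖ ≤ ‖z‖ := by
  refine norm_c0Sum_le (norm_nonneg _) fun j => ?_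
  rw [c0Proj_c0Trunc]
  split_ifs
  · exact norm_c0Proj_le j z
  · simp

theorem norm_sub_c0Trunc_le (n : ℕ) (z : c0Sum Y) : ‖z - c0Trunc n z‖ ≤ ‖z‖ := by
  refine norm_c0Sum_le (norm_nonneg _) fun j => ?_
  rw [map_sub, c0Proj_c0Trunc]
  split_ifs
  · simp
  · simpa using norm_c0Proj_le j z

theorem tendsto_c0Trunc (z : c0Sum Y) : Tendsto (fun n => c0Trunc n z) atTop (𝓝 z) := by
  have hz : Tendsto (fun i => ‖c0Proj i z‖) atTop (𝓝 0) := z.2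
  rw [Metric.tendsto_atTop] at hz ⊢
  intro ε hε
  obtain ⟨N, hN⟩ := hz (ε / 2) (by positivity)
  refine ⟨N, fun n hn => ?_⟩
  rw [dist_comm, dist_eq_norm]
  refine lt_of_le_of_lt (norm_c0Sum_le (half_pos hε).le fun j => ?_) (half_lt_self hε)
  rw [map_sub, c0Proj_c0Trunc]
  split_ifs with h
  · rw [sub_self, norm_zero]; exact (half_pos hε).le
  · have := hN j (by omega)
    simp only [dist_zero_right, norm_norm] at this
    simpa using this.le

/-- A bounded operator from a `c₀`-sum to a Hilbert space is the norm limit of its truncations. -/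
theorem exists_norm_sub_c0Trunc_le {H : Type w} [NormedAddCommGroup H] [InnerProductSpace ℂ H]
    (W : c0Sum Y →L[ℂ] H) {ε : ℝ} (hε : 0 < ε) :
    ∃ n, ∀ z, ‖W z - W (c0Trunc n z)‖ ≤ ε * ‖z‖ := by
  by_contra! hcon
  -- A gliding hump: finitely supported vectors in the unit ball have images of unbounded norm,
  -- contradicting the boundedness of `W`.
  have key : ∀ N : ℕ, ∃ (m : ℕ) (z : c0Sum Y), (∀ j, m ≤ j → c0Proj j z = 0) ∧ ‖z‖ ≤ 1 ∧
      N * (ε / 2) ^ 2 ≤ ‖W z‖ ^ 2 := by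
    intro N
    induction N with
    | zero => exact ⟨0, 0, by simp, by simp, by simp⟩
    | succ N ih =>
      obtain ⟨m, z, hz, hz1, hzW⟩ := ih
      obtain ⟨x, hx⟩ := hcon m
      have hx0 : 0 < ‖x‖ := norm_pos_iff.2 (by rintro rfl; simp at hx)
      set y := ((‖x‖⁻¹ : ℝ) : ℂ) • (x - c0Trunc m x) with hy
      have hy1 : ‖y‖ ≤ 1 := by
        rw [hy, norm_smul, Complex.norm_real, norm_inv, norm_norm, inv_mul_le_iff₀ hx0, mul_one]
        exact norm_sub_c0Trunc_le m x
      have hym : ∀ j, j < m → c0Proj j y = 0 := fun j hj => by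
        rw [hy, map_smul, map_sub, c0Proj_c0Trunc, if_pos hj, sub_self, smul_zero]
      have hyW : ε < ‖W y‖ := by
        rw [hy, map_smul, norm_smul, Complex.norm_real, norm_inv, norm_norm, inv_mul_eq_div,
          lt_div_iff₀ hx0, map_sub]
        exact hx
      have htend : Tendsto (fun n => ‖W (c0Trunc n y)‖) atTop (𝓝 ‖W y‖) :=
        ((W.continuous.tendsto y).comp (tendsto_c0Trunc y)).norm
      -- Cutting the tail vector `y` to finite support lowers the bound from `ε` to `ε / 2`.
      obtain ⟨n, hn, hmn⟩ := ((htend.eventually (lt_mem_nhds (show ε / 2 < ‖W y‖ by linarith))).and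
        (eventually_ge_atTop m)).exists
      have hdis : ∀ j, c0Proj j z = 0 ∨ c0Proj j (c0Trunc n y) = 0 := fun j => by
        rcases lt_or_ge j m with h | h
        · right; rw [c0Proj_c0Trunc, hym j h, ite_self]
        · exact Or.inl (hz j h)
      have hn1 : ‖c0Trunc n y‖ ≤ 1 := (norm_c0Trunc_le n y).trans hy1
      have hvan : ∀ j, n ≤ j → c0Proj j (c0Trunc n y) = 0 := fun j hj => by
        rw [c0Proj_c0Trunc, if_neg (not_lt.2 hj)]
      have hpar := parallelogram_law_with_norm ℂ (W z) (W (c0Trunc n y))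
      have hsq : (ε / 2) ^ 2 ≤ ‖W (c0Trunc n y)‖ ^ 2 := by gcongr
      -- By the parallelogram law one of the two signs does at least as well as orthogonality would;
      -- disjoint supports keep either choice in the unit ball.
      have hor : ((N + 1 : ℕ) : ℝ) * (ε / 2) ^ 2 ≤ ‖W (z + c0Trunc n y)‖ ^ 2 ∨
          ((N + 1 : ℕ) : ℝ) * (ε / 2) ^ 2 ≤ ‖W (z - c0Trunc n y)‖ ^ 2 := by
        by_contra! hlt
        rw [map_add, map_sub] at hlt
        push_cast at hlt
        linarith [hlt.1, hlt.2]
      rcases hor with h | h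
      · refine ⟨n, _, fun j hj => ?_, norm_c0Sum_le zero_le_one fun j => ?_, h⟩
        · rw [map_add, hz j (hmn.trans hj), hvan j hj, add_zero]
        · rw [map_add]
          rcases hdis j with h' | h' <;> rw [h']
          · rw [zero_add]; exact (norm_c0Proj_le j _).trans hn1
          · rw [add_zero]; exact (norm_c0Proj_le j _).trans hz1
      · refine ⟨n, _, fun j hj => ?_, norm_c0Sum_le zero_le_one fun j => ?_, h⟩
        · rw [map_sub, hz j (hmn.trans hj), hvan j hj, sub_zero]
        · rw [map_sub]
          rcases hdis j with h' | h' <;> rw [h']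
          · rw [zero_sub, norm_neg]; exact (norm_c0Proj_le j _).trans hn1
          · rw [sub_zero]; exact (norm_c0Proj_le j _).trans hz1
  obtain ⟨N, hN⟩ := exists_nat_gt (‖W‖ ^ 2 / (ε / 2) ^ 2)
  rw [div_lt_iff₀ (by positivity)] at hN
  obtain ⟨m, z, -, hz1, hzW⟩ := key N
  have : ‖W z‖ ≤ ‖W‖ := (W.le_opNorm_of_le hz1).trans_eq (mul_one _)
  have := pow_le_pow_left₀ (norm_nonneg _) this 2
  linarith

end C0Sum

/-! ### Norms of operator matrices, rows and columns -/

section MatrixNorms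

variable {K : Type u} [NormedAddCommGroup K] [InnerProductSpace ℂ K] {n : ℕ}

theorem opMatrix_conjTranspose [CompleteSpace K] (T : Matrix (Fin n) (Fin n) (BOp K)) :
    opMatrix T.conjTranspose = ContinuousLinearMap.adjoint (opMatrix T) := by
  rw [ContinuousLinearMap.eq_adjoint_iff]
  intro ξ η
  simp only [PiLp.inner_apply, opMatrix_apply, sum_inner, inner_sum, Matrix.conjTranspose_apply,
    ContinuousLinearMap.star_eq_adjoint, ContinuousLinearMap.adjoint_inner_left]
  exact Finset.sum_comm

theorem norm_opMatrix_conjTranspose [CompleteSpace K] (T : Matrix (Fin n) (Fin n) (BOp K)) :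
    ‖opMatrix T.conjTranspose‖ = ‖opMatrix T‖ := by
  rw [opMatrix_conjTranspose, LinearIsometryEquiv.norm_map]

/-- Test `opMatrix T` on the vector with entries `c j • η`. -/
theorem sum_norm_sq_le_norm_opMatrix (T : Matrix (Fin n) (Fin n) (BOp K)) (c : Fin n → ℂ) (η : K) :
    ∑ i, ‖∑ j, c j • T i j η‖ ^ 2 ≤ ‖opMatrix T‖ ^ 2 * (∑ j, ‖c j‖ ^ 2) * ‖η‖ ^ 2 := by
  let ξ : PiLp 2 (fun _ : Fin n => K) := WithLp.toLp 2 fun j => c j • η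
  have h1 := pow_le_pow_left₀ (norm_nonneg _) ((opMatrix T).le_opNorm ξ) 2
  rw [mul_pow, pi_norm_sq, pi_norm_sq] at h1
  simpa [opMatrix_apply, ξ, norm_smul, mul_pow, ← Finset.sum_mul, mul_assoc] using h1

variable [CompleteSpace K]

theorem sum_norm_sq_le_norm_sum_star_mul_self {ι : Type*} (s : Finset ι) (a : ι → BOp K) (η : K) :
    ∑ i ∈ s, ‖a i η‖ ^ 2 ≤ ‖∑ i ∈ s, star (a i) * a i‖ * ‖η‖ ^ 2 := by
  have h1 : ∑ i ∈ s, ‖a i η‖ ^ 2 = RCLike.re (inner ℂ ((∑ i ∈ s, star (a i) * a i) η) η) := by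
    rw [sum_apply, sum_inner, map_sum]
    refine Finset.sum_congr rfl fun i _ => ?_
    rw [mul_apply_eq_comp, ContinuousLinearMap.star_eq_adjoint,
      ContinuousLinearMap.adjoint_inner_left, inner_self_eq_norm_sq]
  rw [h1, sq, ← mul_assoc]
  refine (re_inner_le_norm _ _).trans ?_
  gcongr
  exact ContinuousLinearMap.le_opNorm _ _

/-- With `S` the sum, `‖S η‖² = ∑ ⟨a i η, a i (S η)⟩`; use Cauchy–Schwarz and the hypothesis at both
`η` and `S η`. -/
theorem norm_sum_star_mul_self_le {ι : Type*} (s : Finset ι) (a : ι → BOp K) {C : ℝ} (hC : 0 ≤ C)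
    (h : ∀ η, ∑ i ∈ s, ‖a i η‖ ^ 2 ≤ C * ‖η‖ ^ 2) : ‖∑ i ∈ s, star (a i) * a i‖ ≤ C := by
  refine ContinuousLinearMap.opNorm_le_bound _ hC fun η => ?_
  set S := ∑ i ∈ s, star (a i) * a i with hS
  have h1 : ‖S η‖ ^ 2 = ∑ i ∈ s, RCLike.re (inner ℂ (a i η) (a i (S η))) := by
    rw [← inner_self_eq_norm_sq (𝕜 := ℂ)]
    nth_rw 1 [hS]
    rw [sum_apply, sum_inner, map_sum]
    refine Finset.sum_congr rfl fun i _ => ?_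
    rw [mul_apply_eq_comp, ContinuousLinearMap.star_eq_adjoint,
      ContinuousLinearMap.adjoint_inner_left]
  have h2 : ‖S η‖ ^ 2 ≤ (C * ‖η‖) * ‖S η‖ := by
    refine le_of_sq_le_sq ?_ (by positivity)
    calc (‖S η‖ ^ 2) ^ 2 ≤ (∑ i ∈ s, ‖a i η‖ * ‖a i (S η)‖) ^ 2 := by
          rw [h1]
          refine pow_le_pow_left₀ (h1 ▸ by positivity) ?_ 2
          exact Finset.sum_le_sum fun i _ => re_inner_le_norm _ _
      _ ≤ (∑ i ∈ s, ‖a i η‖ ^ 2) * ∑ i ∈ s, ‖a i (S η)‖ ^ 2 :=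
          Finset.sum_mul_sq_le_sq_mul_sq _ _ _
      _ ≤ (C * ‖η‖ ^ 2) * (C * ‖S η‖ ^ 2) := by
          gcongr
          · exact h η
          · exact h _
      _ = _ := by ring
  rcases (norm_nonneg (S η)).eq_or_lt with h0 | h0
  · rw [← h0]; positivity
  · exact le_of_mul_le_mul_right (by rwa [← sq]) h0

theorem norm_opMatrix_sq_le_of_column (T : Matrix (Fin n) (Fin n) (BOp K)) (j₀ : Fin n)
    (h : ∀ i j, j ≠ j₀ → T i j = 0) :
    ‖opMatrix T‖ ^ 2 ≤ ‖∑ i, star (T i j₀) * T i j₀‖ := by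
  rw [← Real.sq_sqrt (norm_nonneg (∑ i, star (T i j₀) * T i j₀))]
  refine pow_le_pow_left₀ (norm_nonneg _) ?_ 2
  refine ContinuousLinearMap.opNorm_le_bound _ (Real.sqrt_nonneg _) fun ξ => ?_
  refine le_of_sq_le_sq ?_ (mul_nonneg (Real.sqrt_nonneg _) (norm_nonneg _))
  rw [mul_pow, Real.sq_sqrt (norm_nonneg _), pi_norm_sq]
  have h1 : ∀ i, opMatrix T ξ i = T i j₀ (ξ j₀) := fun i => by
    rw [opMatrix_apply]
    exact Finset.sum_eq_single_of_mem j₀ (Finset.mem_univ _) fun j _ hj => by simp [h i j hj]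
  simp only [h1]
  refine (sum_norm_sq_le_norm_sum_star_mul_self _ _ _).trans ?_
  gcongr
  exact PiLp.norm_apply_le ξ j₀

/-- A matrix of operators `rankOne h b` is bounded by a matrix `T` if the columns of its scalar
linear combinations are bounded by those of `T`. -/
theorem norm_opMatrix_rankOne_le {H : Type v} [NormedAddCommGroup H] [InnerProductSpace ℂ H]
    (b : H) (hb : ‖b‖ ≤ 1) (h : Matrix (Fin n) (Fin n) H) (T : Matrix (Fin n) (Fin n) (BOp K))
    (M : ℝ) (hM : 0 ≤ M)
    (hT : ∀ c : Fin n → ℂ, ∑ i, ‖∑ j, c j • h i j‖ ^ 2 ≤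
      M * ‖∑ i, star (∑ j, c j • T i j) * ∑ j, c j • T i j‖) :
    ‖opMatrix (h.map fun x => InnerProductSpace.rankOne ℂ x b)‖ ≤ √M * ‖opMatrix T‖ := by
  refine ContinuousLinearMap.opNorm_le_bound _ (by positivity) fun ξ => ?_
  refine le_of_sq_le_sq ?_ (by positivity)
  rw [mul_pow, mul_pow, Real.sq_sqrt hM, pi_norm_sq, pi_norm_sq]
  -- The matrix sees `ξ` only through the scalars `⟨b, ξ j⟩`, which serve as the coefficients `c` in
  -- `hT`.
  have h1 : ∀ i, opMatrix (h.map fun x => InnerProductSpace.rankOne ℂ x b) ξ i =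
      ∑ j, (inner ℂ b (ξ j) : ℂ) • h i j := fun i => by simp [opMatrix_apply]
  simp only [h1]
  refine (hT _).trans ?_
  rw [mul_assoc]
  gcongr
  refine (norm_sum_star_mul_self_le _ _ (C := ‖opMatrix T‖ ^ 2 * ∑ j, ‖inner ℂ b (ξ j)‖ ^ 2)
    (by positivity) fun η => ?_).trans ?_
  · simpa using sum_norm_sq_le_norm_opMatrix T _ η
  · gcongr with j
    refine (norm_inner_le_norm _ _).trans ?_
    exact mul_le_of_le_one_left (norm_nonneg _) hb

end MatrixNorms

/-! ### Row and column spaces as copies of `ℓ₂` -/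

section RowColumn

theorem norm_stdBasis (i : ℕ) : ‖stdBasis i‖ = 1 := by
  rw [stdBasis, lp.norm_single (by norm_num), norm_one]

theorem inner_stdBasis_stdBasis_self (i : ℕ) : inner ℂ (stdBasis i) (stdBasis i) = (1 : ℂ) := by
  rw [inner_self_eq_norm_sq_to_K, norm_stdBasis]; simp

theorem mem_closure_span_stdBasis (x : Ell2) :
    x ∈ (Submodule.span ℂ (Set.range stdBasis)).topologicalClosure := by
  have h := lp.hasSum_single (p := 2) (by simp) x
  refine mem_closure_of_tendsto h (Eventually.of_forall fun s => ?_)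
  refine Submodule.sum_mem _ fun i _ => ?_
  have : lp.single 2 i (x i) = x i • stdBasis i := by
    rw [stdBasis, ← lp.single_smul, smul_eq_mul, mul_one]
  rw [this]
  exact Submodule.smul_mem _ _ (Submodule.subset_span ⟨i, rfl⟩)

theorem star_stdBasis (i : ℕ) : star (stdBasis i) = stdBasis i := by
  ext j
  rw [lp.star_apply, stdBasis]
  by_cases h : j = i
  · subst h; simp
  · simp [Pi.single_eq_of_ne h]

/-- The isometry of `ℓ₂` onto the column space. -/
def columnMap : Ell2 →L[ℂ] BOp Ell2 := (InnerProductSpace.rankOne ℂ).flip (stdBasis 0)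

theorem columnMap_apply (x : Ell2) :
    columnMap x = InnerProductSpace.rankOne ℂ x (stdBasis 0) := rfl

/-- The isometry of `ℓ₂` onto the row space. -/
def rowMap : Ell2 →L[ℂ] BOp Ell2 :=
  -- `rankOne` is conjugate linear in its second argument; the conjugation on `ℓ₂` restores
  -- linearity.
  (InnerProductSpace.rankOne ℂ (stdBasis 0)).comp
    (starL ℂ : Ell2 ≃L⋆[ℂ] Ell2).toContinuousLinearMap

theorem rowMap_apply (x : Ell2) :
    rowMap x = InnerProductSpace.rankOne ℂ (stdBasis 0) (star x) := rfl

theorem columnMap_apply_stdBasis (x : Ell2) : columnMap x (stdBasis 0) = x := by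
  rw [columnMap_apply, InnerProductSpace.rankOne_apply, inner_stdBasis_stdBasis_self, one_smul]

theorem star_rowMap (x : Ell2) : star (rowMap x) = columnMap (star x) := by
  rw [rowMap_apply, columnMap_apply, ContinuousLinearMap.star_eq_adjoint,
    InnerProductSpace.adjoint_rankOne]

/-- The inverse of `columnMap`. -/
def columnEval : BOp Ell2 →L[ℂ] Ell2 := ContinuousLinearMap.apply ℂ Ell2 (stdBasis 0)

theorem columnEval_columnMap (x : Ell2) : columnEval (columnMap x) = x :=
  columnMap_apply_stdBasis x

/-- The inverse of `rowMap`. -/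
def rowEval : BOp Ell2 →L[ℂ] Ell2 :=
  (starL ℂ : Ell2 ≃L⋆[ℂ] Ell2).toContinuousLinearMap.comp
    (columnEval.comp (starL ℂ : BOp Ell2 ≃L⋆[ℂ] BOp Ell2).toContinuousLinearMap)

theorem rowEval_rowMap (x : Ell2) : rowEval (rowMap x) = x := by
  change star (columnEval (star (rowMap x))) = x
  rw [star_rowMap, columnEval_columnMap, star_star]

/-- A space spanned by the images of the basis under an operator with a left inverse is the range
of that operator. -/
theorem closure_span_eq_range_of_leftInverse {f : Ell2 →L[ℂ] BOp Ell2} {g : BOp Ell2 →L[ℂ] Ell2}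
    (hgf : ∀ x, g (f x) = x) {m : ℕ → BOp Ell2} (hm : ∀ i, m i = f (stdBasis i)) :
    (∀ x, f x ∈ (Submodule.span ℂ (Set.range m)).topologicalClosure) ∧
      ∀ T ∈ (Submodule.span ℂ (Set.range m)).topologicalClosure, f (g T) = T := by
  constructor
  · intro x
    have hc : IsClosed (f ⁻¹' ((Submodule.span ℂ (Set.range m)).topologicalClosure : Set _)) :=
      (Submodule.isClosed_topologicalClosure _).preimage f.continuous
    refine closure_minimal ?_ hc (mem_closure_span_stdBasis x)
    intro y hy
    refine Submodule.le_topologicalClosure _ ?_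
    have : Submodule.span ℂ (Set.range stdBasis) ≤
        (Submodule.span ℂ (Set.range m)).comap f.toLinearMap := by
      rw [Submodule.span_le]
      rintro _ ⟨i, rfl⟩
      exact Submodule.subset_span ⟨i, hm i⟩
    exact this hy
  · intro T hT
    have hc : IsClosed {T | f (g T) = T} := isClosed_eq (by fun_prop) continuous_id
    refine closure_minimal ?_ hc hT
    intro S hS
    have : Submodule.span ℂ (Set.range m) ≤
        LinearMap.eqLocus (f ∘L g).toLinearMap LinearMap.id := by
      rw [Submodule.span_le]
      rintro _ ⟨i, rfl⟩
      change f (g (m i)) = m i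
      rw [hm, hgf]
    exact this hS

theorem columnMap_mem (x : Ell2) : columnMap x ∈ columnSpace :=
  (closure_span_eq_range_of_leftInverse columnEval_columnMap fun _ => rfl).1 x

theorem columnMap_columnEval {T : BOp Ell2} (hT : T ∈ columnSpace) : columnMap (columnEval T) = T :=
  (closure_span_eq_range_of_leftInverse columnEval_columnMap fun _ => rfl).2 T hT

theorem matrixUnit_zero_eq_rowMap (i : ℕ) : matrixUnit 0 i = rowMap (stdBasis i) := by
  rw [rowMap_apply, star_stdBasis]; rfl

theorem rowMap_mem (x : Ell2) : rowMap x ∈ rowSpace :=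
  (closure_span_eq_range_of_leftInverse rowEval_rowMap matrixUnit_zero_eq_rowMap).1 x

theorem rowMap_rowEval {T : BOp Ell2} (hT : T ∈ rowSpace) : rowMap (rowEval T) = T :=
  (closure_span_eq_range_of_leftInverse rowEval_rowMap matrixUnit_zero_eq_rowMap).2 T hT

end RowColumn

/-! ### Injectivity of the row and column spaces -/

section Extension

theorem matNorm_nonneg {X : Type u} [NormedAddCommGroup X] [NormedSpace ℂ X] [OperatorSpace X]
    {n : ℕ} (x : Matrix (Fin n) (Fin n) X) : 0 ≤ matNorm x := by
  obtain ⟨H, _, _, _, J, hJ⟩ := OperatorSpace.exists_representation (X := X)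
  rw [hJ]
  exact norm_nonneg _

theorem matNorm_zero {X : Type u} [NormedAddCommGroup X] [NormedSpace ℂ X] [OperatorSpace X]
    {n : ℕ} : matNorm (0 : Matrix (Fin n) (Fin n) X) = 0 := by
  obtain ⟨H, _, _, _, J, hJ⟩ := OperatorSpace.exists_representation (X := X)
  have h0 : opMatrix ((0 : Matrix (Fin n) (Fin n) X).map J) = 0 := by
    ext ξ i; simp [opMatrix_apply]
  rw [hJ, h0, norm_zero]

theorem matNorm_submodule (S : Submodule ℂ (BOp Ell2)) [CompleteSpace S] {n : ℕ}
    (x : Matrix (Fin n) (Fin n) S) : matNorm x = ‖opMatrix (x.map S.subtype)‖ := rfl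

theorem sum_norm_sq_ite_eq {n : ℕ} (j₀ : Fin n) :
    ∑ j, ‖(if j = j₀ then 1 else 0 : ℂ)‖ ^ 2 = 1 := by
  rw [Finset.sum_eq_single_of_mem j₀ (Finset.mem_univ _) fun j _ h => by simp [h]]
  simp

variable {X : Type u} [NormedAddCommGroup X] [NormedSpace ℂ X]
  {Z : Type v} [NormedAddCommGroup Z] [NormedSpace ℂ Z] [OperatorSpace Z]

/-- Comparison of the amplifications of a completely bounded map with those of a complete
isomorphic embedding. -/
theorem exists_matNorm_map_sq_le [OperatorSpace X] {V : Type w} [NormedAddCommGroup V] [NormedSpace ℂ V]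
    [OperatorSpace V] {u : X →L[ℂ] Z} (hu : IsCompleteIsomorphicEmbedding u) {v : X →L[ℂ] V}
    (hv : IsCompletelyBounded v) : ∃ M : ℝ, 0 ≤ M ∧
      ∀ (n : ℕ) (x : Matrix (Fin n) (Fin n) X), matNorm (x.map v) ^ 2 ≤ M * matNorm (x.map u) ^ 2 := by
  obtain ⟨-, c, hc, hu⟩ := hu
  obtain ⟨k, hv⟩ := hv
  refine ⟨(|k| / c) ^ 2, sq_nonneg _, fun n x => ?_⟩
  rw [← mul_pow]
  refine pow_le_pow_left₀ (matNorm_nonneg _) ?_ 2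
  calc _ ≤ k * matNorm x := hv n x
    _ ≤ |k| * matNorm x := by gcongr; exacts [matNorm_nonneg _, le_abs_self k]
    _ = |k| / c * (c * matNorm x) := by field_simp
    _ ≤ _ := by gcongr; exact hu n x

/-- If, relative to a linear map `ρ` of `Z` into a C⋆-algebra, `v` is bounded on columns in terms
of `u`, and maps on `Z` which are bounded on columns are completely bounded, then `v` extends
along `u`. -/
theorem exists_extension_aux {A : Type w} [CStarAlgebra A] {X₀ : Submodule ℂ (BOp Ell2)}
    [CompleteSpace X₀] {u : X →L[ℂ] Z} {v : X →L[ℂ] X₀} (ρ : Z →ₗ[ℂ] A)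
    (hρ : ∀ z, ‖ρ z‖ ≤ ‖z‖) (θ : X₀ →L[ℂ] Ell2) (κ : Ell2 →L[ℂ] X₀) (hκθ : ∀ T, κ (θ T) = T)
    (M : ℝ) (hM : 0 ≤ M)
    (hcol : ∀ (n : ℕ) (_ : Fin n) (x : Fin n → X),
      ∑ i, ‖θ (v (x i))‖ ^ 2 ≤ M * ‖∑ i, star (ρ (u (x i))) * ρ (u (x i))‖)
    (hcb : ∀ W : Z →L[ℂ] Ell2, (∀ (n : ℕ) (z : Fin n → Z),
      ∑ i, ‖W (z i)‖ ^ 2 ≤ M * ‖∑ i, star (ρ (z i)) * ρ (z i)‖) → IsCompletelyBounded (κ ∘L W)) :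
    ∃ W : Z →L[ℂ] X₀, IsCompletelyBounded W ∧ ∀ x, W (u x) = v x := by
  obtain ⟨W, hWu, hW⟩ := exists_extension_of_column_bounded (ρ ∘ₗ u.toLinearMap)
    (θ ∘L v).toLinearMap M hM (fun L => by
      -- `hcol` needs an index for the column holding the list, so the empty list is treated apart.
      rcases L.length.eq_zero_or_pos with h | h
      · rw [List.length_eq_zero_iff] at h
        simp [h]
      · have := hcol L.length ⟨0, h⟩ L.get
        simpa [← Fin.sum_univ_fun_getElem] using this)
  let W' : Z →L[ℂ] Ell2 := LinearMap.mkContinuous (W ∘ₗ ρ) √M fun z => by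
    refine le_of_sq_le_sq ?_ (by positivity)
    have := hW Finset.univ fun _ : Fin 1 => ρ z
    simp only [Finset.univ_unique, Finset.sum_singleton, CStarRing.norm_star_mul_self] at this
    rw [mul_pow, Real.sq_sqrt hM]
    refine this.trans ?_
    rw [← sq]
    gcongr
    exact hρ z
  refine ⟨κ ∘L W', hcb W' fun n z => hW Finset.univ fun i => ρ (z i), fun x => ?_⟩
  change κ (W (ρ (u x))) = v x
  rw [← hκθ (v x)]
  exact congrArg κ (hWu x)

/-- Matrices supported in one column turn complete boundedness into the column estimate; conversely
`norm_opMatrix_rankOne_le` makes a column-bounded map into the column space completely bounded. -/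
theorem exists_extension_column [OperatorSpace X] [CompleteSpace columnSpace]
    {u : X →L[ℂ] Z}
    (hu : IsCompleteIsomorphicEmbedding u) {v : X →L[ℂ] columnSpace} (hv : IsCompletelyBounded v) :
    ∃ W : Z →L[ℂ] columnSpace, IsCompletelyBounded W ∧ ∀ x, W (u x) = v x := by
  obtain ⟨M, hM, h⟩ := exists_matNorm_map_sq_le hu hv
  obtain ⟨K, _, _, _, J, hJ⟩ := OperatorSpace.exists_representation (X := Z)
  refine exists_extension_aux J.toLinearMap (fun z => (J.norm_map z).le)
    (columnEval ∘L columnSpace.subtypeL) (columnMap.codRestrict _ columnMap_mem)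
    (fun T => Subtype.ext (columnMap_columnEval T.2)) M hM (fun n j₀ x => ?_) (fun W hW => ?_)
  · let x' : Matrix (Fin n) (Fin n) X := Matrix.of fun i j => if j = j₀ then x i else 0
    have h1 := h n x'
    have h2 := norm_opMatrix_sq_le_of_column ((x'.map u).map J) j₀ fun i j hj => by simp [x', hj]
    have h3 := sum_norm_sq_le_norm_opMatrix ((x'.map v).map columnSpace.subtype)
      (fun j => if j = j₀ then 1 else 0) (stdBasis 0)
    rw [hJ] at h1
    have h4 : ∑ i, ‖columnEval (v (x i))‖ ^ 2 ≤ matNorm (x'.map v) ^ 2 := by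
      rw [sum_norm_sq_ite_eq] at h3
      rw [matNorm_submodule]
      simpa [x', norm_stdBasis, columnEval] using h3
    refine (h4.trans h1).trans ?_
    gcongr
    simpa [x'] using h2
  · refine ⟨√M, fun n z => ?_⟩
    rw [hJ]
    refine norm_opMatrix_rankOne_le (stdBasis 0) (norm_stdBasis 0).le (z.map W) (z.map J) M hM
      fun c => ?_
    simpa using hW n fun i => ∑ j, c j • z i j

/-- In the opposite algebra `star a * a` becomes `a * star a`, so row estimates are column estimates
there. Unlike the adjoint, the passage to the opposite algebra is linear. -/
theorem exists_extension_row [OperatorSpace X] [CompleteSpace rowSpace] {u : X →L[ℂ] Z}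
    (hu : IsCompleteIsomorphicEmbedding u) {v : X →L[ℂ] rowSpace} (hv : IsCompletelyBounded v) :
    ∃ W : Z →L[ℂ] rowSpace, IsCompletelyBounded W ∧ ∀ x, W (u x) = v x := by
  obtain ⟨M, hM, h⟩ := exists_matNorm_map_sq_le hu hv
  obtain ⟨K, _, _, _, J, hJ⟩ := OperatorSpace.exists_representation (X := Z)
  have hop : ∀ {n : ℕ} (a : Fin n → BOp K),
      ‖∑ i, star (MulOpposite.op (a i)) * MulOpposite.op (a i)‖ =
        ‖∑ i, star (star (a i)) * star (a i)‖ := fun a => by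
    rw [← MulOpposite.norm_unop]
    simp
  refine exists_extension_aux ((MulOpposite.opLinearEquiv ℂ).toLinearMap ∘ₗ J.toLinearMap)
    (fun z => (J.norm_map z).le) (rowEval ∘L rowSpace.subtypeL) (rowMap.codRestrict _ rowMap_mem)
    (fun T => Subtype.ext (rowMap_rowEval T.2)) M hM (fun n j₀ x => ?_) (fun W hW => ?_)
  · let x' : Matrix (Fin n) (Fin n) X := Matrix.of fun i j => if i = j₀ then x j else 0
    have h1 := h n x'
    have h2 := norm_opMatrix_sq_le_of_column ((x'.map u).map J).conjTranspose j₀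
      fun i j hj => by simp [x', hj]
    have h3 := sum_norm_sq_le_norm_opMatrix ((x'.map v).map rowSpace.subtype).conjTranspose
      (fun j => if j = j₀ then 1 else 0) (stdBasis 0)
    rw [norm_opMatrix_conjTranspose] at h2 h3
    rw [hJ] at h1
    have h5 : ∀ T, ‖rowEval T‖ = ‖star T (stdBasis 0)‖ := fun T => norm_star (star T (stdBasis 0))
    have h4 : ∑ i, ‖rowEval (v (x i))‖ ^ 2 ≤ matNorm (x'.map v) ^ 2 := by
      rw [sum_norm_sq_ite_eq] at h3
      rw [matNorm_submodule]
      simpa [x', norm_stdBasis, h5] using h3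
    refine (h4.trans h1).trans ?_
    gcongr
    refine h2.trans_eq ?_
    simpa [x'] using (hop fun i => J (u (x i))).symm
  · refine ⟨√M, fun n z => ?_⟩
    rw [hJ]
    have e0 : ((z.map ((rowMap.codRestrict _ rowMap_mem) ∘L W)).map rowSpace.subtype) =
        (z.map W).map rowMap := rfl
    rw [matNorm_submodule, e0]
    rw [← norm_opMatrix_conjTranspose, ← norm_opMatrix_conjTranspose (z.map J)]
    have e1 : ((z.map W).map rowMap).conjTranspose =
        (z.map W).conjTranspose.map fun x => InnerProductSpace.rankOne ℂ x (stdBasis 0) := by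
      ext1 i j
      simp only [Matrix.conjTranspose_apply, Matrix.map_apply]
      rw [star_rowMap, columnMap_apply]
    rw [e1]
    refine norm_opMatrix_rankOne_le (stdBasis 0) (norm_stdBasis 0).le _ (z.map J).conjTranspose M hM
      fun c => ?_
    -- Conjugated coefficients allow the adjoint to be taken outside the whole combination.
    have h1 := hW n fun i => ∑ j, star (c j) • z j i
    have h2 : ∀ i, ∑ j, c j • (z.map W).conjTranspose i j = star (W (∑ j, star (c j) • z j i)) :=
      fun i => by simp
    have h3 : ∀ i, ∑ j, c j • (z.map J).conjTranspose i j = star (J (∑ j, star (c j) • z j i)) :=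
      fun i => by simp
    simp only [h2, h3, norm_star]
    refine h1.trans_eq ?_
    congr 1
    exact hop fun i => J (∑ j, star (c j) • z j i)

/-- The row and column spaces are injective with respect to complete isomorphic embeddings. -/
theorem exists_completelyBounded_extension [OperatorSpace X] {X₀ : Submodule ℂ (BOp Ell2)}
    (hX₀ : X₀ = rowSpace ∨ X₀ = columnSpace) [CompleteSpace X₀] {u : X →L[ℂ] Z}
    (hu : IsCompleteIsomorphicEmbedding u) {v : X →L[ℂ] X₀} (hv : IsCompletelyBounded v) :
    ∃ W : Z →L[ℂ] X₀, IsCompletelyBounded W ∧ ∀ x, W (u x) = v x := by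
  rcases hX₀ with rfl | rfl
  · exact exists_extension_row hu hv
  · exact exists_extension_column hu hv

theorem exists_continuousLinearEquiv_ell2 {X₀ : Submodule ℂ (BOp Ell2)}
    (hX₀ : X₀ = rowSpace ∨ X₀ = columnSpace) : Nonempty (X₀ ≃L[ℂ] Ell2) := by
  rcases hX₀ with rfl | rfl
  · exact ⟨.equivOfInverse (rowEval ∘L rowSpace.subtypeL) (rowMap.codRestrict _ rowMap_mem)
      (fun T => Subtype.ext (rowMap_rowEval T.2)) rowEval_rowMap⟩
  · exact ⟨.equivOfInverse (columnEval ∘L columnSpace.subtypeL)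
      (columnMap.codRestrict _ columnMap_mem)
      (fun T => Subtype.ext (columnMap_columnEval T.2)) columnEval_columnMap⟩

theorem not_finiteDimensional_ell2 : ¬ FiniteDimensional ℂ Ell2 := by
  intro h
  have hli : LinearIndependent ℂ stdBasis := by
    refine Orthonormal.linearIndependent ⟨norm_stdBasis, fun i j hij => ?_⟩
    simp only [stdBasis]
    rw [lp.inner_single_left, lp.single_apply_ne _ _ _ hij, inner_zero_right]
  exact not_finite_iff_infinite.2 inferInstance hli.finite

theorem IsCompletelyBounded.comp_c0Single {Y : ℕ → Type v} [∀ i, NormedAddCommGroup (Y i)]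
    [∀ i, NormedSpace ℂ (Y i)] [∀ i, OperatorSpace (Y i)] {V : Type w} [NormedAddCommGroup V]
    [NormedSpace ℂ V] [OperatorSpace V] {W : c0Sum Y →L[ℂ] V} (hW : IsCompletelyBounded W)
    (i : ℕ) : IsCompletelyBounded (W ∘L c0Single i) := by
  obtain ⟨k, hk⟩ := hW
  refine ⟨|k|, fun n y => ?_⟩
  have h1 : matNorm (y.map (c0Single i)) ≤ matNorm y := by
    refine ciSup_le fun j => ?_
    by_cases h : j = i
    · subst h
      refine le_of_eq (congrArg _ ?_)
      ext a b
      exact c0Proj_c0Single_self j _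
    · refine le_trans (le_of_eq ?_) (matNorm_nonneg y)
      rw [← matNorm_zero (X := Y j) (n := n)]
      refine congrArg _ ?_
      ext a b
      exact c0Proj_c0Single_of_ne h _
  calc _ ≤ k * matNorm (y.map (c0Single i)) := hk n (y.map (c0Single i))
    _ ≤ |k| * matNorm (y.map (c0Single i)) := by
      gcongr; exacts [matNorm_nonneg _, le_abs_self k]
    _ ≤ _ := by gcongr

end Extension

end OpSpace
-- The contradiction
open OpSpace in
theorem mainTheorem8
    (X₀ : Submodule ℂ (BOp Ell2)) (hX₀ : X₀ = rowSpace ∨ X₀ = columnSpace)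
    [CompleteSpace X₀]
    (X : Type*) [NormedAddCommGroup X] [NormedSpace ℂ X] [OperatorSpace X]
    (hX : IsHilbertian X)
    (hsurj : ∃ v : X →L[ℂ] X₀, IsCompletelyBounded v ∧ Function.Surjective v)
    (Y : ℕ → Type*) [∀ i, NormedAddCommGroup (Y i)] [∀ i, NormedSpace ℂ (Y i)]
    [∀ i, OperatorSpace (Y i)]
    (hY : ∀ (i : ℕ) (w : Y i →L[ℂ] X₀), IsCompletelyBounded w → StrictlyCosingular w) :
    ¬ ∃ u : X →L[ℂ] c0Sum Y, IsCompleteIsomorphicEmbedding u := by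
  rintro ⟨u, hu⟩
  obtain ⟨v, hv, hvs⟩ := hsurj
  obtain ⟨H, _, _, _, ⟨e⟩⟩ := hX
  obtain ⟨W, hW, hWu⟩ := exists_completelyBounded_extension hX₀ hu hv
  obtain ⟨θ⟩ := exists_continuousLinearEquiv_ell2 hX₀
  let s : H →L[ℂ] c0Sum Y := u ∘L e.symm
  let θW : c0Sum Y →L[ℂ] Ell2 := (θ : X₀ →L[ℂ] Ell2) ∘L W
  have hcomp : ∀ x, θW (s x) = θ (v (e.symm x)) := fun x => congrArg θ (hWu _)
  have hsmall : IsSmall (θW ∘L s) := by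
    refine isSmall_of_approx fun ε hε => ?_
    -- The tolerance absorbs the norm of `s`; the `+ 1` covers `s = 0`.
    obtain ⟨n, hn⟩ := exists_norm_sub_c0Trunc_le θW (ε := ε / (‖s‖ + 1)) (by positivity)
    refine ⟨∑ i ∈ Finset.range n,
      (θ : X₀ →L[ℂ] Ell2) ∘L (W ∘L c0Single i) ∘L (c0Proj i ∘L s), ?_, fun x => ?_⟩
    · exact isSmall_sum _ _ fun i _ => (hY i _ (hW.comp_c0Single i)).isSmall _ _
    · have h1 : (∑ i ∈ Finset.range n,
          (θ : X₀ →L[ℂ] Ell2) ∘L (W ∘L c0Single i) ∘L (c0Proj i ∘L s)) x =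
          θW (c0Trunc n (s x)) := by
        simp [c0Trunc, θW]
      rw [h1]
      calc _ ≤ _ := hn (s x)
        _ ≤ ε / (‖s‖ + 1) * ((‖s‖ + 1) * ‖x‖) := by
          gcongr
          exact (s.le_opNorm x).trans (by gcongr; linarith)
        _ = ε * ‖x‖ := by field_simp
  -- The composite equals `θ ∘ v ∘ e.symm`, which is onto since `v` is.
  refine not_finiteDimensional_ell2 (hsmall.finiteDimensional_of_surjective fun y => ?_)
  obtain ⟨x, hx⟩ := hvs (θ.symm y)
  exact ⟨e x, by simp [hcomp, hx]⟩
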